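/- Let $\Sigma$ be a finite alphabet. For $k\ge 1$, the $k$-rewbs over $\Sigma$ and their label sets $\mathrm{var}$ are generated by: $a\in\Sigma\cup\{\varepsilon\}$ (with $\mathrm{var}=\emptyset$); references $\backslash i$ with $1\le i\le k$ (with $\mathrm{var}=\{i\}$); $\alpha_0\alpha_1$, $\alpha_0+\alpha_1$ and $\alpha_0^*$ (with $\mathrm{var}$ the union over the parts); and captures $(_j\,\alpha_0\,)_j$ with $1\le j\le k$ and $j\notin\mathrm{var}(\alpha_0)$ (with $\mathrm{var}=\mathrm{var}(\alpha_0)\cup\{j\}$). A rewb over $\Sigma$ is an ordinary regular expression over $\Sigma$ or a $k$-rewb for some $k\ge 1$. The language $L(\alpha)$ of a regular expression is the usual one. For a $k$-rewb, $L(\alpha)=\{\mathcal D_k(v): v\in\mathcal R_k(\alpha)\}$, where $\mathcal R_k(\alpha)$ is the regular language over $\Sigma\uplus\{[_i,]_i: 1\le i\le k\}\uplus\{1,\dots,k\}$ obtained by reading $\backslash i$ as the symbol $i$ and $(_j\,\alpha_0\,)_j$ as $[_j\,\alpha_0\,]_j$, and where $\mathcal D_k$ replaces, from left to right, each symbol $i$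 by the string (brackets deleted) between the nearest preceding $[_i$ and the first $]_i$ after that $[_i$ — by $\varepsilon$ if no $[_i$ precedes, being undefined if the required $]_i$ does not occur before the symbol $i$ — and finally deletes all brackets. A rewb is without a captured reference if no reference $\backslash i$ occurs inside any capture $(_j\cdots)_j$. A (one-way nondeterministic) stack automaton has finite sets $Q$ of states and $\Gamma$ of stack symbols, a start state, an initial stack symbol $Z_0\in\Gamma$, a set of final states, and a stack $\#Z_1\cdots Z_n\$$ with a pointer to one of $\#,Z_1,\dots,Z_n$. Each move depends on the state, the current input symbol, and the symbol pointed to (and whether this is the topmost symbol $Z_n$, a lower one, or $\#$). It changes the state, leaves the input cursor in place or moves it one symbol to the right, and either moves the pointer — only down from the topmost symbol; down, not at all, or up from a lower symbol $Z_j$ with $1\le j<n$; only up from $\#$ — or, if the pointer is at the topmost symbol $Z$, replaces $Z$ by a string $w\in\Gamma^*$, with the pointer moving to the new top; in each situation only finitely many moves are possible. No move is made once the input is exhausted. A word is accepted if some computation starting in the start state with stack $\#Z_0\$$ and pointer at $Z_0$ consumes the whole input and ends in a final state. The automaton is nonerasing if every replacing string $w$ begins with the replaced symbol $Z$; a nonerasing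 stack language is a language recognized by a nonerasing stack automaton. Then: 1. For every finite alphabet $\Sigma$ and every rewb $\alpha$ over $\Sigma$ without a captured reference, $L(\alpha)$ is a nonerasing stack language. 2. The converse fails: it is not the case that every nonerasing stack language over a finite alphabet is described by a rewb without a captured reference. 3. More precisely, for every finite alphabet $\Sigma$ and all distinct $a,b\in\Sigma$, the language $\{a^nb^n: n\in\mathbb N\}$ is a nonerasing stack language, but no rewb over $\Sigma$ (with or without captured references) describes it. -/

import Mathlib

universe u

open scoped Computability

/-! ### Regular expressions with backreferences -/

/-- Raw expressions with labels `[k]` (represented by `Fin k`): a letter or `ε`, a reference `\i`,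
concatenation, alternation, Kleene star, and the capture `(_j α )_j`. The side condition on
captures is `PreRewb.WellFormed`. -/
inductive PreRewb (A : Type u) (k : ℕ) : Type u
  | eps : PreRewb A k
  | letter : A → PreRewb A k
  | ref : Fin k → PreRewb A k
  | concat : PreRewb A k → PreRewb A k → PreRewb A k
  | alt : PreRewb A k → PreRewb A k → PreRewb A k
  | star : PreRewb A k → PreRewb A k
  | capture : Fin k → PreRewb A k → PreRewb A k

/-- The alphabet `Σ ⊎ B_k ⊎ [k]`: letters, brackets `[_i` and `]_i`, and label symbols `i`. -/
inductive RefSym (A : Type u) (k : ℕ) : Type u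
  | letter : A → RefSym A k
  | opening : Fin k → RefSym A k
  | closing : Fin k → RefSym A k
  | ref : Fin k → RefSym A k

namespace RefSym

variable {A : Type u} {k : ℕ}

/-- Is the symbol the left bracket `[_i`? -/
def isOpening (i : Fin k) : RefSym A k → Bool
  | opening j => decide (j = i)
  | _ => false

/-- Is the symbol the right bracket `]_i`? -/
def isClosing (i : Fin k) : RefSym A k → Bool
  | closing j => decide (j = i)
  | _ => false

/-- The letter carried by a symbol, if any. -/
def toLetter? : RefSym A k → Option A
  | letter a => some a
  | _ => none

/-- The homomorphism keeping letters and erasing brackets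
(it is only applied to strings without label symbols). -/
def eraseBrackets (v : List (RefSym A k)) : List A :=
  v.filterMap toLetter?

/-- The part of `p` strictly after its rightmost `[_i` (all of `p` if there is no `[_i`). -/
def afterLastOpening (i : Fin k) (p : List (RefSym A k)) : List (RefSym A k) :=
  (p.reverse.takeWhile fun x => !isOpening i x).reverse

/-- The string that replaces a label symbol `i` preceded by the (already dereferenced) string `p`:
it is `ε` if `p` contains no `[_i`; otherwise it is the string between the rightmost `[_i` in `p`
and the first `]_i` after it, with brackets erased, undefined if there is no such `]_i`. -/
def capturedValue (i : Fin k) (p : List (RefSym A k)) : Option (List A) :=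
  if p.any (isOpening i) then
    if (afterLastOpening i p).any (isClosing i) then
      some (eraseBrackets ((afterLastOpening i p).takeWhile fun x => !isClosing i x))
    else none
  else some []

/-- `derefFrom p v` dereferences `p v`, where `p` contains no label symbol: the label symbols of
`v` are replaced from left to right, and in the end all brackets are erased. -/
def derefFrom : List (RefSym A k) → List (RefSym A k) → Option (List A)
  | p, [] => some (eraseBrackets p)
  | p, ref i :: v =>
    match capturedValue i p with
    | some w => derefFrom (p ++ w.map letter) v
    | none => none
  | p, letter a :: v => derefFrom (p ++ [letter a]) v
  | p, opening j :: v => derefFrom (p ++ [opening j]) v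
  | p, closing j :: v => derefFrom (p ++ [closing j]) v

/-- The dereferencing partial function `D_k : (Σ ⊎ B_k ⊎ [k])* ⇀ Σ*`. -/
def deref (v : List (RefSym A k)) : Option (List A) :=
  derefFrom [] v

end RefSym

namespace PreRewb

variable {A : Type u} {k : ℕ}

/-- The labels occurring in an expression, in references or captures. -/
def var : PreRewb A k → Set (Fin k)
  | eps => ∅
  | letter _ => ∅
  | ref i => {i}
  | concat α β => var α ∪ var β
  | alt α β => var α ∪ var β
  | star α => var α
  | capture j α => var α ∪ {j}

/-- Every capture `(_j α )_j` satisfies `j ∉ var α`. -/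
def WellFormed : PreRewb A k → Prop
  | eps => True
  | letter _ => True
  | ref _ => True
  | concat α β => WellFormed α ∧ WellFormed β
  | alt α β => WellFormed α ∧ WellFormed β
  | star α => WellFormed α
  | capture j α => j ∉ var α ∧ WellFormed α

/-- No reference occurs as a subexpression. -/
def ReferenceFree : PreRewb A k → Prop
  | eps => True
  | letter _ => True
  | ref _ => False
  | concat α β => ReferenceFree α ∧ ReferenceFree β
  | alt α β => ReferenceFree α ∧ ReferenceFree β
  | star α => ReferenceFree α
  | capture _ α => ReferenceFree α

/-- No reference occurs inside a capture. -/
def NoCapturedReference : PreRewb A k → Prop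
  | eps => True
  | letter _ => True
  | ref _ => True
  | concat α β => NoCapturedReference α ∧ NoCapturedReference β
  | alt α β => NoCapturedReference α ∧ NoCapturedReference β
  | star α => NoCapturedReference α
  | capture _ α => ReferenceFree α

/-- The regular language `R_k(α)` over `Σ ⊎ B_k ⊎ [k]`. -/
def refWords : PreRewb A k → Language (RefSym A k)
  | eps => 1
  | letter a => {[RefSym.letter a]}
  | ref i => {[RefSym.ref i]}
  | concat α β => refWords α * refWords β
  | alt α β => refWords α + refWords β
  | star α => (refWords α)∗
  | capture j α => {[RefSym.opening j]} * refWords α * {[RefSym.closing j]}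

end PreRewb

/-- Rewbs over `A`: regular expressions, and `k`-rewbs for `k ≥ 1`. -/
inductive Rewb (A : Type u) : Type u
  | regular (r : RegularExpression A) : Rewb A
  | backref (k : ℕ) (hk : 1 ≤ k) (α : PreRewb A k) (hα : α.WellFormed) : Rewb A

namespace Rewb

variable {A : Type u}

/-- No reference `\i` occurs inside a capture `(_j … )_j`. -/
def NoCapturedReference : Rewb A → Prop
  | regular _ => True
  | backref _ _ α _ => α.NoCapturedReference

/-- The language described by a rewb, `L(α) = { D_k(v) | v ∈ R_k(α) }`. -/
def language : Rewb A → Language A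
  | regular r => r.matches'
  | backref _ _ α _ => {w | ∃ v ∈ α.refWords, RefSym.deref v = some w}

end Rewb

/-! ### One-way nondeterministic stack automata -/

/-- Moves of the input cursor (`S` and `R`). -/
inductive InputMove
  | stay
  | right

/-- Moves of the stack pointer (`L`, `S` and `R`). -/
inductive StackMove
  | left
  | stay
  | right

/-- The remaining input after the cursor, standing on `a` with `u` to its right, moves. -/
def InputMove.apply {A : Type u} : InputMove → A → List A → List A
  | stay, a, u => a :: u
  | right, _, u => u

/-- A one-way nondeterministic stack automaton with input alphabet `A`, states `Q` and stack
symbols `Γ`. The bottom marker `#` and top marker `$` of the stack are implicit. -/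
structure StackAutomaton (A : Type u) (Q Γ : Type) where
  /-- start state -/
  start : Q
  /-- initial stack symbol -/
  initSym : Γ
  /-- final states -/
  final : Set Q
  /-- pushdown mode: `(q', d, w$) ∈ δ(q, a, Z$)` -/
  push : Q → A → Γ → Set (Q × InputMove × List Γ)
  /-- as usual, only finitely many moves are possible in every situation -/
  push_finite : ∀ q a Z, (push q a Z).Finite
  /-- stack reading mode at the top: `(q', d, L) ∈ δ(q, a, Z$)` -/
  readTop : Q → A → Γ → Set (Q × InputMove)
  /-- stack reading mode strictly inside the stack: `(q', d, e) ∈ δ(q, a, Z)` -/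
  readInside : Q → A → Γ → Set (Q × InputMove × StackMove)
  /-- stack reading mode at the bottom: `(q', d, R) ∈ δ(q, a, #)` -/
  readBottom : Q → A → Set (Q × InputMove)

/-- An instantaneous description. The stack `# y₁ ↾ y₂ $`, whose pointer references the last
symbol of `# y₁`, is stored as `left = y₁.reverse` and `right = y₂`. -/
structure StackAutomaton.ID (A : Type u) (Q Γ : Type) where
  /-- current state -/
  state : Q
  /-- remaining input, starting at the cursor -/
  input : List A
  /-- stack symbols up to the pointer, from the pointer down to the bottom -/
  left : List Γ
  /-- stack symbols above the pointer, from the pointer up to the top -/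
  right : List Γ

namespace StackAutomaton

variable {A : Type u} {Q Γ : Type}

/-- One step of computation. -/
inductive Step (M : StackAutomaton A Q Γ) : ID A Q Γ → ID A Q Γ → Prop
  | push {q q' : Q} {a : A} {u : List A} {d : InputMove} {Z : Γ} {w y : List Γ} :
      (q', d, w) ∈ M.push q a Z →
      Step M ⟨q, a :: u, Z :: y, []⟩ ⟨q', d.apply a u, w.reverse ++ y, []⟩
  | readTop {q q' : Q} {a : A} {u : List A} {d : InputMove} {Z : Γ} {y : List Γ} :
      (q', d) ∈ M.readTop q a Z →
      Step M ⟨q, a :: u, Z :: y, []⟩ ⟨q', d.apply a u, y, [Z]⟩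
  | insideLeft {q q' : Q} {a : A} {u : List A} {d : InputMove} {Z Y : Γ} {y z : List Γ} :
      (q', d, StackMove.left) ∈ M.readInside q a Z →
      Step M ⟨q, a :: u, Z :: y, Y :: z⟩ ⟨q', d.apply a u, y, Z :: Y :: z⟩
  | insideStay {q q' : Q} {a : A} {u : List A} {d : InputMove} {Z Y : Γ} {y z : List Γ} :
      (q', d, StackMove.stay) ∈ M.readInside q a Z →
      Step M ⟨q, a :: u, Z :: y, Y :: z⟩ ⟨q', d.apply a u, Z :: y, Y :: z⟩
  | insideRight {q q' : Q} {a : A} {u : List A} {d : InputMove} {Z Y : Γ} {y z : List Γ} :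
      (q', d, StackMove.right) ∈ M.readInside q a Z →
      Step M ⟨q, a :: u, Z :: y, Y :: z⟩ ⟨q', d.apply a u, Y :: Z :: y, z⟩
  | readBottom {q q' : Q} {a : A} {u : List A} {d : InputMove} {Z : Γ} {z : List Γ} :
      (q', d) ∈ M.readBottom q a →
      Step M ⟨q, a :: u, [], Z :: z⟩ ⟨q', d.apply a u, [Z], z⟩

/-- The language `L(M)`: acceptance by final state with the whole input consumed, starting from
the stack `# Z₀ ↾ $`. -/
def language (M : StackAutomaton A Q Γ) : Language A :=
  {w | ∃ qf ∈ M.final, ∃ y z : List Γ,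
    Relation.ReflTransGen M.Step ⟨M.start, w, [M.initSym], []⟩ ⟨qf, [], y, z⟩}

/-- The automaton is nonerasing: `(q', d, w$) ∈ δ(q, a, Z$)` implies `w ∈ Z Γ*`. -/
def Nonerasing (M : StackAutomaton A Q Γ) : Prop :=
  ∀ q a Z q' d w, (q', d, w) ∈ M.push q a Z → ∃ w', w = Z :: w'

end StackAutomaton

/-- `L` is a nonerasing stack language: it is recognized by a nonerasing stack automaton with
finitely many states and stack symbols. -/
def IsNonerasingStackLanguage {A : Type u} (L : Language A) : Prop :=
  ∃ (Q Γ : Type) (_ : Finite Q) (_ : Finite Γ) (M : StackAutomaton A Q Γ),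
    M.Nonerasing ∧ M.language = L

/-- The language `{aⁿ bⁿ | n ∈ ℕ}`. -/
def powPowLanguage {A : Type u} (a b : A) : Language A :=
  {w | ∃ n : ℕ, w = List.replicate n a ++ List.replicate n b}

/-! Every rewb amounts to a regular language of strings with brackets and label symbols, followed by
dereferencing (`Rewb.exists_isRegular_language_eq`). Both directions therefore start from a DFA for
that regular language.

Inclusion: a nonerasing automaton guesses a string accepted by the DFA, matches its letters against
the input and pushes its letters and brackets. At a label `i` it descends to the nearest `[_i` and
climbs again, matching the captured string against the input. The substituted strings are never
pushed. This is harmless when every register is closed at each reference, because a substituted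
string is then recorded by no register; so stack lookup agrees with dereferencing
(`RefSym.derefFrom_eq_emit`, `RefState.language_automaton`).

Strictness: references only repeat earlier output, so the first `b` of `aⁿbⁿ` stems from a letter
(`RefSym.exists_first_letter`). Cut the string there. Registers then hold powers of `a`, and a
nonempty one can no longer be used unless it is reopened, since only `b`s are still to come
(`RefSym.derefFrom_of_registerEquiv`). What follows thus depends only on the DFA state and on which
registers are unset, open or empty. Two exponents agree in this finite information, and exchanging
their prefixes yields an output with unequal exponents. A stack automaton, in contrast, recognizes
the language by pushing along the `a`s and descending along the `b`s. -/

namespace Language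

/-! ### Closure of regular languages under the rational operations, by counting left quotients. -/

variable {T : Type*} {L M : Language T}

theorem isRegular_zero : (0 : Language T).IsRegular := by
  refine IsRegular.of_finite_range_leftQuotient ((Set.finite_singleton 0).subset ?_)
  rintro _ ⟨x, rfl⟩
  rfl

theorem isRegular_one : (1 : Language T).IsRegular := by
  refine IsRegular.of_finite_range_leftQuotient ((Set.toFinite {0, 1}).subset ?_)
  rintro _ ⟨_ | ⟨c, x⟩, rfl⟩
  · exact Or.inr rfl
  · refine Or.inl (Language.ext fun y => ?_)
    simp [mem_one, Language.notMem_zero]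

theorem isRegular_singleton (c : T) : ({[c]} : Language T).IsRegular := by
  refine IsRegular.of_finite_range_leftQuotient ((Set.toFinite {0, 1, {[c]}}).subset ?_)
  rintro _ ⟨_ | ⟨d, _ | ⟨e, x⟩⟩, rfl⟩
  · exact Or.inr (Or.inr rfl)
  · by_cases h : d = c
    · refine Or.inr (Or.inl (Language.ext fun y => ?_))
      rw [mem_leftQuotient, mem_one]
      exact ⟨fun hy => by simpa [h] using (show [d] ++ y = [c] from hy),
        fun hy => by subst hy h; rfl⟩
    · refine Or.inl (Language.ext fun y => ?_)
      rw [mem_leftQuotient]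
      exact ⟨fun hy => absurd (List.cons.inj (show [d] ++ y = [c] from hy)).1 h,
        fun hy => absurd hy (notMem_zero y)⟩
  · refine Or.inl (Language.ext fun y => ?_)
    rw [mem_leftQuotient]
    exact ⟨fun hy => by simpa using (show d :: e :: x ++ y = [c] from hy),
      fun hy => absurd hy (notMem_zero y)⟩

/-- A word `x` either ends inside the factor from `L` or splits as `y ++ z` with `y ∈ L`. The
quotient by `x` is thus fixed by one quotient of `L` and a set of quotients of `M`, which leaves
finitely many possibilities. -/
theorem IsRegular.mul (hL : L.IsRegular) (hM : M.IsRegular) : (L * M).IsRegular := by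
  have hf := (hL.finite_range_leftQuotient.prod hM.finite_range_leftQuotient.finite_subsets).image
    fun p : Language T × Set (Language T) => p.1 * M + sSup p.2
  refine IsRegular.of_finite_range_leftQuotient (hf.subset ?_)
  rintro _ ⟨x, rfl⟩
  refine ⟨(L.leftQuotient x, {K | ∃ y ∈ L, ∃ z, y ++ z = x ∧ M.leftQuotient z = K}),
    ⟨⟨x, rfl⟩, ?_⟩, Language.ext fun w => ?_⟩
  · rintro _ ⟨y, -, z, -, rfl⟩
    exact ⟨z, rfl⟩
  · rw [mem_add, mem_leftQuotient, mem_mul, mem_mul]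
    constructor
    · rintro (⟨u, hu, v, hv, rfl⟩ | ⟨_, ⟨y, hy, z, rfl, rfl⟩, hw⟩)
      · exact ⟨x ++ u, hu, v, hv, List.append_assoc ..⟩
      · exact ⟨y, hy, z ++ w, hw, (List.append_assoc ..).symm⟩
    · rintro ⟨u, hu, v, hv, h⟩
      rcases List.append_eq_append_iff.1 h with ⟨t, rfl, rfl⟩ | ⟨t, rfl, rfl⟩
      · exact Or.inr ⟨_, ⟨u, hu, t, rfl, rfl⟩, hv⟩
      · exact Or.inl ⟨t, hu, v, hv, rfl⟩

theorem exists_of_append_mem_kstar {x w : List T} (hx : x ≠ []) (h : x ++ w ∈ L∗) :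
    ∃ y ∈ L∗, ∃ z, y ++ z = x ∧ w ∈ L.leftQuotient z * L∗ := by
  obtain ⟨S, hS, hSL⟩ := mem_kstar.1 h
  clear h
  induction S generalizing x with
  | nil => simp_all
  | cons s S ih =>
    have hS' : S.flatten ∈ L∗ := join_mem_kstar fun y hy => hSL y (List.mem_cons_of_mem _ hy)
    have hs : s ∈ L := hSL s List.mem_cons_self
    rw [List.flatten_cons] at hS
    rcases List.append_eq_append_iff.1 hS with ⟨t, rfl, rfl⟩ | ⟨t, rfl, ht⟩
    · exact ⟨[], nil_mem_kstar L, x, rfl, mem_mul.2 ⟨t, hs, _, hS', rfl⟩⟩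
    · by_cases h0 : t = []
      · subst h0
        refine ⟨[], nil_mem_kstar L, s ++ [], rfl, mem_mul.2 ⟨[], ?_, _, hS', ?_⟩⟩
        · simpa using hs
        · simpa using ht
      · obtain ⟨y, hy, z, rfl, hw⟩ := ih h0 ht.symm fun y hy => hSL y (List.mem_cons_of_mem _ hy)
        refine ⟨s ++ y, ?_, z, List.append_assoc .., hw⟩
        obtain ⟨S', rfl, hS''⟩ := mem_kstar.1 hy
        exact mem_kstar.2 ⟨s :: S', rfl, by simpa using ⟨hs, hS''⟩⟩

theorem IsRegular.kstar (hL : L.IsRegular) : (L∗).IsRegular := by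
  have hf := ((hL.finite_range_leftQuotient.finite_subsets).image
    fun P : Set (Language T) => ({y | ∃ K ∈ P, y ∈ K * L∗} : Language T)).insert (L∗)
  refine IsRegular.of_finite_range_leftQuotient (hf.subset ?_)
  rintro _ ⟨x, rfl⟩
  -- The empty word is separate: its only split would give `L * L∗`, which may lack the empty word.
  by_cases hx : x = []
  · subst hx
    exact Or.inl rfl
  refine Or.inr ⟨{K | ∃ y ∈ L∗, ∃ z, y ++ z = x ∧ L.leftQuotient z = K}, ?_,
    Language.ext fun w => ?_⟩
  · rintro _ ⟨y, -, z, -, rfl⟩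
    exact ⟨z, rfl⟩
  · rw [mem_leftQuotient]
    constructor
    · rintro ⟨_, ⟨y, hy, z, rfl, rfl⟩, hw⟩
      obtain ⟨s, hs, t, ht, rfl⟩ := mem_mul.1 hw
      obtain ⟨Y, rfl, hY⟩ := mem_kstar.1 hy
      obtain ⟨U, rfl, hU⟩ := mem_kstar.1 ht
      refine mem_kstar.2 ⟨Y ++ (z ++ s) :: U, by simp, fun y hy => ?_⟩
      rcases List.mem_append.1 hy with h | h
      · exact hY y h
      · rcases List.mem_cons.1 h with rfl | h
        · exact hs
        · exact hU y h
    · intro h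
      obtain ⟨y, hy, z, hz, hw⟩ := exists_of_append_mem_kstar hx h
      exact ⟨_, ⟨y, hy, z, hz, rfl⟩, hw⟩

end Language

theorem RegularExpression.isRegular_matches' {T : Type*} (r : RegularExpression T) :
    r.matches'.IsRegular := by
  induction r with
  | zero => exact Language.isRegular_zero
  | epsilon => exact Language.isRegular_one
  | char c => exact Language.isRegular_singleton c
  | plus r s hr hs => exact hr.add hs
  | comp r s hr hs => exact hr.mul hs
  | star r hr => exact hr.kstar

theorem PreRewb.isRegular_refWords {A : Type u} {k : ℕ} (α : PreRewb A k) :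
    α.refWords.IsRegular := by
  induction α with
  | eps => exact Language.isRegular_one
  | letter a => exact Language.isRegular_singleton _
  | ref i => exact Language.isRegular_singleton _
  | concat α β hα hβ => exact hα.mul hβ
  | alt α β hα hβ => exact hα.add hβ
  | star α hα => exact hα.kstar
  | capture j α hα =>
    exact ((Language.isRegular_singleton _).mul hα).mul (Language.isRegular_singleton _)

/-! ### Dereferencing through registers updated symbol by symbol. -/

/-- The content of one memory cell: `none` if it was never opened, otherwise whether it is still
open, together with the string recorded since it was last opened. -/
abbrev Register (A : Type u) : Type u := Option (Bool × List A)

namespace RefSym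

variable {A : Type u} {k : ℕ}

/-- The effect of a symbol on the register of label `i`. -/
def stepRegister (i : Fin k) (r : Register A) : RefSym A k → Register A
  | letter a => r.map fun p => if p.1 then (true, p.2 ++ [a]) else p
  | opening j => if j = i then some (true, []) else r
  | closing j => if j = i then r.map fun p => (false, p.2) else r
  | ref _ => r

/-- The register of label `i` after reading a string. -/
def register (i : Fin k) (p : List (RefSym A k)) : Register A :=
  p.foldl (stepRegister i) none

/-- The string that a reference to a register stands for. -/
def registerValue : Register A → Option (List A)
  | none => some []
  | some (true, _) => none
  | some (false, w) => some w

theorem register_append (i : Fin k) (p q : List (RefSym A k)) :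
    register i (p ++ q) = q.foldl (stepRegister i) (register i p) :=
  List.foldl_append ..

theorem register_append_singleton (i : Fin k) (p : List (RefSym A k)) (x : RefSym A k) :
    register i (p ++ [x]) = stepRegister i (register i p) x :=
  register_append i p [x]

theorem eraseBrackets_append (p q : List (RefSym A k)) :
    eraseBrackets (p ++ q) = eraseBrackets p ++ eraseBrackets q :=
  List.filterMap_append ..

theorem eraseBrackets_map_letter (w : List A) :
    eraseBrackets (w.map (letter (k := k))) = w := by
  simp only [eraseBrackets, List.filterMap_map]
  exact List.filterMap_some

theorem afterLastOpening_append_singleton (i : Fin k) (p : List (RefSym A k)) (x : RefSym A k) :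
    afterLastOpening i (p ++ [x]) =
      if isOpening i x then [] else afterLastOpening i p ++ [x] := by
  by_cases h : isOpening i x <;> simp [afterLastOpening, h]

/-- Phrases the update through the tests used by `capturedValue`, so that `register_eq` needs only
Boolean cases. -/
theorem stepRegister_eq (i : Fin k) (r : Register A) (x : RefSym A k) :
    stepRegister i r x = if isOpening i x then some (true, []) else
      if isClosing i x then r.map fun p => (false, p.2) else
      r.map fun p => if p.1 then (true, p.2 ++ eraseBrackets [x]) else p := by
  rcases r with _ | ⟨_ | _, w⟩ <;> cases x <;>
    simp [stepRegister, isOpening, isClosing, eraseBrackets, toLetter?, List.filterMap_cons]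

theorem eraseBrackets_takeWhile_append_singleton (f : RefSym A k → Bool)
    (q : List (RefSym A k)) (x : RefSym A k) :
    eraseBrackets ((q ++ [x]).takeWhile fun x => !f x) =
      if q.any f || f x then eraseBrackets (q.takeWhile fun x => !f x)
      else eraseBrackets (q.takeWhile fun x => !f x) ++ eraseBrackets [x] := by
  induction q with
  | nil => by_cases h : f x = true <;> simp [h, eraseBrackets]
  | cons y q ih =>
    by_cases h : f y = true
    · simp [h, eraseBrackets]
    · have hc : ∀ t, eraseBrackets ((y :: t).takeWhile fun x => !f x) =
          eraseBrackets [y] ++ eraseBrackets (t.takeWhile fun x => !f x) := fun t => by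
        rw [List.takeWhile_cons_of_pos (by simpa using h), ← eraseBrackets_append]
        rfl
      rw [List.cons_append, hc, hc, ih, List.any_cons, Bool.eq_false_iff.2 h, Bool.false_or]
      split_ifs <;> simp

/-- The left-to-right fold finds what the definition of captured values finds by searching
backwards: a new `[_i` resets the record, and the first `]_i` after it freezes the record. -/
theorem register_eq (i : Fin k) (p : List (RefSym A k)) :
    register i p = if p.any (isOpening i) then
      some (!(afterLastOpening i p).any (isClosing i),
        eraseBrackets ((afterLastOpening i p).takeWhile fun x => !isClosing i x)) else none := by
  induction p using List.reverseRecOn with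
  | nil => rfl
  | append_singleton p x ih =>
    rw [register_append_singleton, ih, afterLastOpening_append_singleton, stepRegister_eq]
    by_cases ho : isOpening i x = true
    · simp [ho, eraseBrackets]
    · rw [if_neg ho, if_neg ho, eraseBrackets_takeWhile_append_singleton, List.any_append,
        List.any_append, List.any_cons, List.any_cons, Bool.eq_false_iff.2 ho]
      by_cases hp : p.any (isOpening i) = true
      · by_cases hq : (afterLastOpening i p).any (isClosing i) = true <;>
          by_cases hc : isClosing i x = true <;> simp [hp, hq, hc]
      · simp [hp]

theorem capturedValue_eq (i : Fin k) (p : List (RefSym A k)) :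
    capturedValue i p = registerValue (register i p) := by
  rw [register_eq, capturedValue]
  by_cases ho : p.any (isOpening i) = true
  · by_cases hc : (afterLastOpening i p).any (isClosing i) = true
    · rw [if_pos ho, if_pos ho, if_pos hc, hc]
      rfl
    · rw [if_pos ho, if_pos ho, if_neg hc, Bool.eq_false_iff.2 hc]
      rfl
  · rw [if_neg ho, if_neg ho]
    rfl

theorem mem_eraseBrackets_of_register {i : Fin k} {p : List (RefSym A k)} {o : Bool} {w : List A}
    (h : register i p = some (o, w)) {a : A} (ha : a ∈ w) : a ∈ eraseBrackets p := by
  rw [register_eq] at h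
  split_ifs at h
  obtain ⟨-, rfl⟩ := Prod.mk.inj (Option.some.inj h)
  simp only [eraseBrackets, List.mem_filterMap] at ha ⊢
  obtain ⟨x, hx, hxa⟩ := ha
  have := (List.takeWhile_prefix _).subset hx
  rw [afterLastOpening, List.mem_reverse] at this
  exact ⟨x, List.mem_reverse.1 ((List.takeWhile_prefix _).subset this), hxa⟩

theorem mem_eraseBrackets_of_capturedValue {i : Fin k} {p : List (RefSym A k)} {w : List A}
    (h : capturedValue i p = some w) {a : A} (ha : a ∈ w) : a ∈ eraseBrackets p := by
  rw [capturedValue_eq] at h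
  cases hr : register i p with
  | none => simp_all [registerValue]
  | some q =>
    obtain ⟨_ | _, c⟩ := q
    · rw [hr] at h
      obtain rfl := Option.some.inj h
      exact mem_eraseBrackets_of_register hr ha
    · simp_all [registerValue]

/-- Output already produced is never revised; this allows it to be cancelled later. -/
theorem prefix_of_derefFrom {v p : List (RefSym A k)} {w : List A}
    (h : derefFrom p v = some w) : eraseBrackets p <+: w := by
  induction v generalizing p with
  | nil => exact Option.some.inj h ▸ List.prefix_rfl
  | cons x v ih =>
    have key : ∀ q, derefFrom (p ++ q) v = some w → eraseBrackets p <+: w := fun q hq => by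
      have := ih hq
      rw [eraseBrackets_append] at this
      exact (List.prefix_append _ _).trans this
    cases x with
    | letter a => exact key _ h
    | opening j => exact key _ h
    | closing j => exact key _ h
    | ref j =>
      rw [derefFrom] at h
      cases hc : capturedValue j p with
      | none => simp [hc] at h
      | some c => exact key (c.map letter) (by simpa [hc] using h)

/-! ### No regular language with references yields `{aⁿ bⁿ}`. -/

/-- Registers that are equal, or agree except for their contents, which both contain `a`. -/
def RegisterEquiv (a : A) (r r' : Register A) : Prop :=
  r = r' ∨ ∃ o w w', r = some (o, w) ∧ r' = some (o, w') ∧ a ∈ w ∧ a ∈ w'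

/-- Reopening makes both registers equal; every other symbol keeps the recorded letters and treats
the open flags alike. -/
theorem RegisterEquiv.step {a : A} {r r' : Register A} (h : RegisterEquiv a r r') (i : Fin k)
    (x : RefSym A k) : RegisterEquiv a (stepRegister i r x) (stepRegister i r' x) := by
  obtain rfl | ⟨o, w, w', rfl, rfl, hw, hw'⟩ := h
  · exact Or.inl rfl
  · cases x with
    | letter b => cases o <;> exact Or.inr ⟨_, _, _, rfl, rfl, by simp [hw], by simp [hw']⟩
    | opening j =>
      simp only [stepRegister]
      split_ifs
      · exact Or.inl rfl
      · exact Or.inr ⟨_, _, _, rfl, rfl, hw, hw'⟩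
    | closing j =>
      simp only [stepRegister]
      split_ifs
      · exact Or.inr ⟨_, _, _, rfl, rfl, hw, hw'⟩
      · exact Or.inr ⟨_, _, _, rfl, rfl, hw, hw'⟩
    | ref j => exact Or.inr ⟨_, _, _, rfl, rfl, hw, hw'⟩

theorem RegisterEquiv.append {a : A} {i : Fin k} {p p' : List (RefSym A k)}
    (h : RegisterEquiv a (register i p) (register i p')) (q : List (RefSym A k)) :
    RegisterEquiv a (register i (p ++ q)) (register i (p' ++ q)) := by
  rw [register_append, register_append]
  generalize register i p = r, register i p' = r' at h
  induction q generalizing r r' with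
  | nil => exact h
  | cons x q ih => exact ih _ _ (h.step i x)

/-- If the remaining output avoids `a`, it does not depend on the contents of registers
containing `a`. -/
theorem derefFrom_of_registerEquiv {a : A} {v p p' : List (RefSym A k)} {w : List A}
    (hp : ∀ i, RegisterEquiv a (register i p) (register i p')) (ha : a ∉ w)
    (h : derefFrom p v = some (eraseBrackets p ++ w)) :
    derefFrom p' v = some (eraseBrackets p' ++ w) := by
  induction v generalizing p p' w with
  | nil =>
    have : w = [] := by simpa [derefFrom] using h
    simp [derefFrom, this]
  | cons x v ih =>
    have key : ∀ q, derefFrom (p ++ q) v = some (eraseBrackets p ++ w) →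
        derefFrom (p' ++ q) v = some (eraseBrackets p' ++ w) := fun q hq => by
      obtain ⟨t, ht⟩ := prefix_of_derefFrom hq
      rw [eraseBrackets_append, List.append_assoc, List.append_cancel_left_eq] at ht
      subst ht
      rw [← List.append_assoc, ← eraseBrackets_append] at hq
      rw [ih (fun i => (hp i).append q) (fun hat => ha (List.mem_append_right _ hat)) hq,
        eraseBrackets_append, List.append_assoc]
    cases x with
    | letter b => exact key _ h
    | opening j => exact key _ h
    | closing j => exact key _ h
    | ref j =>
      rw [derefFrom] at h ⊢
      cases hc : capturedValue j p with
      | none => simp [hc] at h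
      | some c =>
        simp only [hc] at h
        suffices hc' : capturedValue j p' = some c by simpa only [hc'] using key _ h
        rw [capturedValue_eq] at hc ⊢
        obtain he | ⟨o, d, d', hd, -, had, -⟩ := hp j
        · rw [← he, hc]
        -- A register containing `a` cannot be referenced here: if closed it would emit `a`, and if
        -- open the result would be undefined.
        · obtain ⟨t, ht⟩ := prefix_of_derefFrom h
          rw [eraseBrackets_append, eraseBrackets_map_letter, List.append_assoc,
            List.append_cancel_left_eq] at ht
          cases o
          · rw [hd] at hc
            obtain rfl := Option.some.inj hc
            exact absurd (ht ▸ List.mem_append_left _ had) ha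
          · simp [hd, registerValue] at hc

/-- The first occurrence of a letter in the output stems from a letter, not from a reference. -/
theorem exists_first_letter {b : A} {v p : List (RefSym A k)} {w : List A}
    (h : derefFrom p v = some w) (hp : b ∉ eraseBrackets p) (hb : b ∈ w) :
    ∃ v₁ v₂ q, v = v₁ ++ letter b :: v₂ ∧ b ∉ eraseBrackets q ∧
      ∀ v', derefFrom p (v₁ ++ v') = derefFrom q v' := by
  induction v generalizing p with
  | nil => exact absurd (Option.some.inj h ▸ hb) hp
  | cons x v ih =>
    have key : ∀ q, derefFrom (p ++ q) v = some w → b ∉ eraseBrackets q →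
        (∀ v', derefFrom p (x :: v') = derefFrom (p ++ q) v') →
        ∃ v₁ v₂ q, x :: v = v₁ ++ letter b :: v₂ ∧ b ∉ eraseBrackets q ∧
          ∀ v', derefFrom p (v₁ ++ v') = derefFrom q v' := fun q hq hbq hx => by
      obtain ⟨v₁, v₂, q', rfl, hq', hv⟩ := ih hq (by simp [eraseBrackets_append, hp, hbq])
      exact ⟨x :: v₁, v₂, q', rfl, hq', fun v' => (hx _).trans (hv v')⟩
    cases x with
    | letter a =>
      by_cases hab : b = a
      · subst hab
        exact ⟨[], v, p, rfl, hp, fun _ => rfl⟩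
      · exact key _ h (by simpa [eraseBrackets, toLetter?] using hab) fun _ => rfl
    | opening j => exact key _ h (by simp [eraseBrackets, toLetter?]) fun _ => rfl
    | closing j => exact key _ h (by simp [eraseBrackets, toLetter?]) fun _ => rfl
    | ref j =>
      have hx : ∀ c, capturedValue j p = some c → ∀ v', derefFrom p (ref j :: v') =
          derefFrom (p ++ c.map letter) v' := fun c hc v' => by rw [derefFrom, hc]
      cases hc : capturedValue j p with
      | none =>
        rw [derefFrom, hc] at h
        exact absurd h (by simp)
      | some c =>
        -- A captured string consists of letters already in the output, so it cannot introduce `b`.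
        refine key (c.map letter) (by rw [← hx c hc, h]) ?_ (hx c hc)
        rw [eraseBrackets_map_letter]
        exact fun hbc => hp (mem_eraseBrackets_of_capturedValue hc hbc)

/-- No regular language of strings with references describes `{aⁿ bⁿ | n ∈ ℕ}`. -/
theorem deref_ne_powPowLanguage {R : Language (RefSym A k)} (hR : R.IsRegular) {a b : A}
    (hab : a ≠ b) : ({w | ∃ v ∈ R, deref v = some w} : Language A) ≠ powPowLanguage a b := by
  intro hL
  obtain ⟨σ, _, M, rfl⟩ := hR
  -- The cut is just before the letter that outputs the first `b`; the exponent `n + 1` ensures that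
  -- there is one. Here `q` is the dereferenced form of `v₁`.
  have hcut : ∀ n : ℕ, ∃ v₁ v₂ q, v₁ ++ v₂ ∈ M.accepts ∧
      eraseBrackets q = List.replicate (n + 1) a ∧
      derefFrom q v₂ = some (eraseBrackets q ++ List.replicate (n + 1) b) ∧
      ∀ v', deref (v₁ ++ v') = derefFrom q v' := by
    intro n
    have hn : List.replicate (n + 1) a ++ List.replicate (n + 1) b ∈ powPowLanguage a b :=
      ⟨_, rfl⟩
    rw [← hL] at hn
    obtain ⟨v, hv, hvn⟩ := hn
    obtain ⟨v₁, v₂, q, rfl, hq, hvq⟩ := exists_first_letter hvn (b := b) (by simp [eraseBrackets])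
      (by simp)
    have hd : derefFrom q (letter b :: v₂) = _ := (hvq _).symm.trans hvn
    obtain ⟨t, ht⟩ := prefix_of_derefFrom (p := q ++ [letter b]) (v := v₂) hd
    have hqa : eraseBrackets q = List.replicate (n + 1) a := by
      rw [eraseBrackets_append, List.append_assoc] at ht
      rcases List.append_eq_append_iff.1 ht with ⟨s, hs, hs'⟩ | ⟨s, hs, hs'⟩
      · cases s with
        | nil => simpa using hs.symm
        | cons c s =>
          have hc : c = b := by simpa [eraseBrackets, toLetter?] using (List.cons.inj hs').1.symm
          have : b ∈ List.replicate (n + 1) a := by rw [hs, hc]; simp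
          exact absurd (List.eq_of_mem_replicate this).symm hab
      · cases s with
        | nil => simpa using hs
        | cons c s =>
          have hc : c ∈ List.replicate (n + 1) b := by rw [hs']; simp
          rw [List.eq_of_mem_replicate hc] at hs
          exact absurd (by simp [hs]) hq
    exact ⟨v₁, letter b :: v₂, q, hv, hqa, by rw [hd, hqa], hvq⟩
  choose v₁ v₂ q hv hq hd hvq using hcut
  -- Finite information suffices: before the cut only `a` has been output, so nonempty contents
  -- contain `a` and are covered by `RegisterEquiv`.
  let abs : Register A → Option (Bool × Bool) := Option.map fun p => (p.1, p.2.isEmpty)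
  obtain ⟨m, n, hmn, he⟩ := Finite.exists_ne_map_eq_of_infinite
    fun n => (M.eval (v₁ n), fun i => abs (register i (q n)))
  obtain ⟨hs, hr⟩ := Prod.mk.inj he
  have hmem : ∀ l i c o, register i (q l) = some (o, c) → c ≠ [] → a ∈ c := by
    intro l i c o h hc
    obtain ⟨d, c, rfl⟩ := List.exists_cons_of_ne_nil hc
    have := mem_eraseBrackets_of_register h List.mem_cons_self
    rw [hq] at this
    simp [List.eq_of_mem_replicate this]
  have hequiv : ∀ i, RegisterEquiv a (register i (q m)) (register i (q n)) := by
    intro i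
    have hi := congrFun hr i
    cases h1 : register i (q m) with
    | none => cases h2 : register i (q n) <;> simp_all [abs, RegisterEquiv]
    | some c1 =>
      cases h2 : register i (q n) with
      | none => simp_all [abs]
      | some c2 =>
        obtain ⟨o1, c1⟩ := c1
        obtain ⟨o2, c2⟩ := c2
        obtain ⟨rfl, hc⟩ : o1 = o2 ∧ c1.isEmpty = c2.isEmpty := by simpa [abs, h1, h2] using hi
        by_cases hc1 : c1 = []
        · subst hc1
          exact Or.inl (by rw [List.isEmpty_iff.1 hc.symm])
        · have hc2 : c2 ≠ [] := fun h => hc1 (by simpa [h] using hc)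
          exact Or.inr ⟨_, _, _, rfl, rfl, hmem _ _ _ _ h1 hc1, hmem _ _ _ _ h2 hc2⟩
  -- The suffix for `m` still outputs its `b`s when placed after the prefix for `n`.
  have hout := derefFrom_of_registerEquiv hequiv
    (fun h => hab (List.eq_of_mem_replicate h)) (hd m)
  have hin : v₁ n ++ v₂ m ∈ M.accepts := by
    have h := hv m
    rw [DFA.mem_accepts, DFA.eval, DFA.evalFrom_of_append] at h ⊢
    rwa [show M.evalFrom M.start (v₁ n) = M.evalFrom M.start (v₁ m) from hs.symm]
  have hpow : eraseBrackets (q n) ++ List.replicate (m + 1) b ∈ powPowLanguage a b := by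
    rw [← hL]
    exact ⟨_, hin, (hvq n _).trans hout⟩
  obtain ⟨l, hl⟩ := hpow
  rw [hq] at hl
  classical
  have ha := congrArg (List.count a) hl
  have hb := congrArg (List.count b) hl
  simp [List.count_replicate, hab, hab.symm] at ha hb
  omega

end RefSym

/-! ### Looking references up on a stack. -/

namespace RefSym

variable {A : Type u} {k : ℕ}

/-- The letters up to the first `]_i`, where `none` marks the bottom of a stack. -/
def copyValue (i : Fin k) : List (Option (RefSym A k)) → Option (List A)
  | some x :: z => if isClosing i x then some [] else (copyValue i z).map (x.toLetter?.toList ++ ·)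
  | _ => none

/-- The value of a reference found by searching `left` downwards for `[_i` or the bottom `none`,
where `right` is the part of the stack above `left`. -/
def seekValue (i : Fin k) : List (Option (RefSym A k)) → List (Option (RefSym A k)) →
    Option (List A)
  | some x :: y, z => if isOpening i x then copyValue i z else seekValue i y (some x :: z)
  | none :: _, _ => some []
  | [], _ => none

/-- The output for `v` when letters and brackets are pushed onto a stack `y` and references are
looked up there. -/
def emit : List (Option (RefSym A k)) → List (RefSym A k) → Option (List A)
  | _, [] => some []
  | y, letter a :: v => (emit (some (letter a) :: y) v).map (a :: ·)
  | y, opening j :: v => emit (some (opening j) :: y) v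
  | y, closing j :: v => emit (some (closing j) :: y) v
  -- The copied string is not pushed: `v` continues on the same stack.
  | y, ref i :: v => (seekValue i y []).bind fun c => (emit y v).map (c ++ ·)

/-- The outputs of strings accepted by `M` from state `s`, given the stack `y`. -/
def emitLanguage {σ : Type} (M : DFA (RefSym A k) σ) (s : σ) (y : List (Option (RefSym A k))) :
    Language A :=
  {w | ∃ v, M.evalFrom s v ∈ M.accept ∧ emit y v = some w}

end RefSym

/-! ### The simulating automaton, with a marked last input letter. -/

/-- Consuming an input letter: either it is read, or it is guessed to be the last one and only
marked as consumed, since no move is possible once the input is exhausted. The Booleans tell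
whether the last letter is marked, before and after. -/
inductive Consumes : Bool → InputMove → Bool → Prop
  | read : Consumes false InputMove.right false
  | last : Consumes false InputMove.stay true

/-- `w` remains to be consumed if `u` remains to be read and `f` tells whether the last letter of
the input is marked as consumed. -/
def Pending {A : Type u} (f : Bool) (w u : List A) : Prop :=
  if f then w = [] ∧ ∃ a, u = [a] else w = u ∧ u ≠ []

section Pending

variable {A : Type u} {f f' : Bool} {d : InputMove} {a : A} {w u t : List A}

theorem Pending.exists_eq_cons (h : Pending f w u) : ∃ a t, u = a :: t := by
  cases f
  · exact List.exists_cons_of_ne_nil h.2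
  · obtain ⟨a, rfl⟩ := h.2
    exact ⟨a, [], rfl⟩

theorem Pending.of_consumes (hc : Consumes f d f') (h : Pending f' w (d.apply a t)) :
    Pending f (a :: w) (a :: t) := by
  cases hc
  · obtain ⟨rfl, -⟩ := h
    exact ⟨rfl, by simp⟩
  · obtain ⟨rfl, b, hb⟩ := h
    obtain ⟨rfl, rfl⟩ := List.cons.inj hb
    exact ⟨rfl, by simp⟩

/-- The right guess is to mark the letter exactly when nothing remains to be consumed after it. -/
theorem Pending.exists_consumes (h : Pending f (a :: w) u) :
    ∃ t d f', u = a :: t ∧ Consumes f d f' ∧ Pending f' w (d.apply a t) := by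
  cases f
  · obtain ⟨rfl, -⟩ := h
    by_cases hw : w = []
    · subst hw
      exact ⟨[], _, _, rfl, .last, rfl, a, rfl⟩
    · exact ⟨w, _, _, rfl, .read, rfl, hw⟩
  · exact absurd h.1 (by simp)

end Pending

/-- States of the stack automaton simulating a deterministic automaton with references: pushing
letters and brackets, searching downwards for `[_i`, copying a captured string, and going back to
the top. -/
inductive RefState (σ : Type) (k : ℕ) : Type
  | init : RefState σ k
  | main : σ → Bool → RefState σ k
  | seek : Fin k → σ → Bool → RefState σ k
  | copy : Fin k → σ → Bool → RefState σ k
  | back : σ → Bool → RefState σ k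
  | done : RefState σ k

instance {σ : Type} {k : ℕ} [Finite σ] : Finite (RefState σ k) := by
  let F : Option (Option ((σ × Bool) ⊕ (σ × Bool) ⊕ (Fin k × σ × Bool) ⊕ (Fin k × σ × Bool))) →
      RefState σ k
    | none => .init
    | some none => .done
    | some (some (.inl (s, f))) => .main s f
    | some (some (.inr (.inl (s, f)))) => .back s f
    | some (some (.inr (.inr (.inl (i, s, f))))) => .seek i s f
    | some (some (.inr (.inr (.inr (i, s, f))))) => .copy i s f
  refine Finite.of_surjective F fun q => ?_
  cases q with
  | init => exact ⟨none, rfl⟩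
  | main s f => exact ⟨some (some (.inl (s, f))), rfl⟩
  | seek i s f => exact ⟨some (some (.inr (.inr (.inl (i, s, f))))), rfl⟩
  | copy i s f => exact ⟨some (some (.inr (.inr (.inr (i, s, f))))), rfl⟩
  | back s f => exact ⟨some (some (.inr (.inl (s, f)))), rfl⟩
  | done => exact ⟨some none, rfl⟩

instance : Finite InputMove :=
  Finite.of_surjective (fun b : Bool => if b then InputMove.stay else InputMove.right) fun d => by
    cases d
    · exact ⟨true, rfl⟩
    · exact ⟨false, rfl⟩

namespace RefState

open RefSym InputMove StackMove

section

variable {A : Type u} {k : ℕ} {σ Γ : Type} (M : DFA (RefSym A k) σ) (g : Γ ≃ Option (RefSym A k))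

/-- Moves in pushdown mode. -/
inductive Push : RefState σ k → A → Γ → RefState σ k × InputMove × List Γ → Prop
  -- Replacing `Z` by `[Z]` serves as a stay move at the top, where reading mode only allows
  -- descending.
  | start {a Z} : Push init a Z (main M.start false, stay, [Z])
  | letter {a Z s f d f'} : Consumes f d f' →
      Push (main s f) a Z (main (M.step s (letter a)) f', d, [Z, g.symm (some (letter a))])
  | opening {a Z s f} (j : Fin k) :
      Push (main s f) a Z (main (M.step s (opening j)) f, stay, [Z, g.symm (some (opening j))])
  | closing {a Z s f} (j : Fin k) :
      Push (main s f) a Z (main (M.step s (closing j)) f, stay, [Z, g.symm (some (closing j))])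
  | ref {a Z s f} (i : Fin k) : Push (main s f) a Z (seek i (M.step s (ref i)) f, stay, [Z])
  | accept {a Z s} : s ∈ M.accept → Push (main s true) a Z (done, InputMove.right, [Z])
  | seekBottom {a Z i s f} : g Z = none → Push (seek i s f) a Z (main s f, stay, [Z])
  | copyEnd {a Z i s f x} : g Z = some x → isClosing i x →
      Push (copy i s f) a Z (main s f, stay, [Z])
  | back {a Z s f} : Push (back s f) a Z (main s f, stay, [Z])

/-- Moves in stack reading mode at the top. -/
inductive ReadTop : RefState σ k → A → Γ → RefState σ k × InputMove → Prop
  | seek {a Z i s f x} : g Z = some x → isOpening i x = false →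
      ReadTop (seek i s f) a Z (seek i s f, stay)

/-- Moves in stack reading mode inside the stack. -/
inductive ReadInside : RefState σ k → A → Γ → RefState σ k × InputMove × StackMove → Prop
  | seekBottom {a Z i s f} : g Z = none →
      ReadInside (seek i s f) a Z (back s f, InputMove.stay, StackMove.right)
  | seekFound {a Z i s f x} : g Z = some x → isOpening i x →
      ReadInside (seek i s f) a Z (copy i s f, InputMove.stay, StackMove.right)
  | seek {a Z i s f x} : g Z = some x → isOpening i x = false →
      ReadInside (seek i s f) a Z (seek i s f, InputMove.stay, left)
  | copyEnd {a Z i s f x} : g Z = some x → isClosing i x →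
      ReadInside (copy i s f) a Z (back s f, InputMove.stay, StackMove.right)
  | copyLetter {a Z i s f d f'} : g Z = some (letter a) → Consumes f d f' →
      ReadInside (copy i s f) a Z (copy i s f', d, StackMove.right)
  | copySkip {a Z i s f x} : g Z = some x → isClosing i x = false → x.toLetter? = none →
      ReadInside (copy i s f) a Z (copy i s f, InputMove.stay, StackMove.right)
  | back {a Z s f} : ReadInside (back s f) a Z (back s f, InputMove.stay, StackMove.right)

theorem Push.exists_eq_cons {M : DFA (RefSym A k) σ} {g : Γ ≃ Option (RefSym A k)}
    {q : RefState σ k} {a : A} {Z : Γ} {m : RefState σ k × InputMove × List Γ}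
    (h : Push M g q a Z m) : ∃ w, m.2.2 = Z :: w ∧ w.length ≤ 1 := by
  cases h <;> exact ⟨_, rfl, by simp⟩

/-- The nonerasing stack automaton that simulates `M` with dereferencing. -/
def automaton [Finite σ] [Finite Γ] : StackAutomaton A (RefState σ k) Γ where
  start := init
  initSym := g.symm none
  -- No move is possible on empty input, so the start state itself has to decide the empty word.
  final := {q | q = done ∨ q = init ∧ [] ∈ emitLanguage M M.start [none]}
  push q a Z := {m | Push M g q a Z m}
  push_finite q a Z := by
    refine (Set.finite_univ.prod (Set.finite_univ.prod (List.finite_length_le Γ 2))).subset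
      (s := Set.univ ×ˢ (Set.univ ×ˢ {l : List Γ | l.length ≤ 2})) ?_
    intro m hm
    obtain ⟨w, hw, hl⟩ := Push.exists_eq_cons hm
    exact ⟨trivial, trivial, by simpa [hw] using hl⟩
  readTop q a Z := {m | ReadTop g q a Z m}
  readInside q a Z := {m | ReadInside g q a Z m}
  readBottom _ _ := ∅

theorem automaton_nonerasing [Finite σ] [Finite Γ] : (automaton M g).Nonerasing :=
  fun _ _ _ _ _ _ h => let ⟨w, hw, _⟩ := Push.exists_eq_cons h; ⟨w, hw⟩

/-- The remaining input of a configuration is an output of the remaining computation. -/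
def Productive (c : StackAutomaton.ID A (RefState σ k) Γ) : Prop :=
  match c.state with
  | init => True
  | main s f => c.right = [] ∧ ∃ w ∈ emitLanguage M s (c.left.map g), Pending f w c.input
  | seek i s f => ∃ v w, seekValue i (c.left.map g) (c.right.map g) = some v ∧
      w ∈ emitLanguage M s ((c.right.reverse ++ c.left).map g) ∧ Pending f (v ++ w) c.input
  | copy i s f => ∃ Z y v w, c.left = Z :: y ∧ copyValue i ((Z :: c.right).map g) = some v ∧
      w ∈ emitLanguage M s ((c.right.reverse ++ c.left).map g) ∧ Pending f (v ++ w) c.input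
  | back s f => ∃ w ∈ emitLanguage M s ((c.right.reverse ++ c.left).map g), Pending f w c.input
  | done => c.input = []

/-! ### Soundness of the simulation. -/

variable {M g}

/-- The invariant is carried backwards from acceptance: a witness for the successor extends by the
symbol or partial lookup that the move performs. -/
theorem Productive.of_step [Finite σ] [Finite Γ] {c c' : StackAutomaton.ID A (RefState σ k) Γ}
    (h : (automaton M g).Step c c') (hc' : Productive M g c') : Productive M g c := by
  cases h with
  | push h =>
    change Push M g _ _ _ _ at h
    cases h with
    | start => trivial
    | letter hf =>
      obtain ⟨-, w, ⟨v, hv, hw⟩, hp⟩ := hc'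
      exact ⟨rfl, _, ⟨.letter _ :: v, hv, by simpa [emit] using hw⟩, hp.of_consumes hf⟩
    | opening j =>
      obtain ⟨-, w, ⟨v, hv, hw⟩, hp⟩ := hc'
      exact ⟨rfl, _, ⟨.opening j :: v, hv, by simpa [emit] using hw⟩, hp⟩
    | closing j =>
      obtain ⟨-, w, ⟨v, hv, hw⟩, hp⟩ := hc'
      exact ⟨rfl, _, ⟨.closing j :: v, hv, by simpa [emit] using hw⟩, hp⟩
    | ref i =>
      obtain ⟨v, w, hv, ⟨t, ht, hw⟩, hp⟩ := hc'
      refine ⟨rfl, _, ⟨.ref i :: t, ht, ?_⟩, hp⟩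
      simp_all [emit]
    | accept hs =>
      have hc' : _ = [] := hc'
      simp only [InputMove.apply] at hc'
      subst hc'
      exact ⟨rfl, [], ⟨[], hs, rfl⟩, rfl, _, rfl⟩
    | seekBottom hZ =>
      obtain ⟨-, w, hw, hp⟩ := hc'
      exact ⟨[], w, by simp [hZ, seekValue], hw, hp⟩
    | copyEnd hZ hx =>
      obtain ⟨-, w, hw, hp⟩ := hc'
      exact ⟨_, _, [], w, rfl, by simp [hZ, copyValue, hx], hw, hp⟩
    | back =>
      obtain ⟨-, w, hw, hp⟩ := hc'
      exact ⟨w, hw, hp⟩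
  | readTop h =>
    change ReadTop g _ _ _ _ at h
    cases h with
    | seek hZ hx =>
      obtain ⟨v, w, hv, hw, hp⟩ := hc'
      exact ⟨v, w, by simpa [hZ, seekValue, hx] using hv, by simpa using hw, hp⟩
  | insideLeft h =>
    change ReadInside g _ _ _ _ at h
    cases h with
    | seek hZ hx =>
      obtain ⟨v, w, hv, hw, hp⟩ := hc'
      exact ⟨v, w, by simpa [hZ, seekValue, hx] using hv, by simpa using hw, hp⟩
  | insideStay h =>
    change ReadInside g _ _ _ _ at h
    cases h
  | insideRight h =>
    change ReadInside g _ _ _ _ at h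
    cases h with
    | seekBottom hZ =>
      obtain ⟨w, hw, hp⟩ := hc'
      exact ⟨[], w, by simp [hZ, seekValue], by simpa using hw, hp⟩
    | seekFound hZ hx =>
      obtain ⟨_, _, v, w, he, hv, hw, hp⟩ := hc'
      obtain ⟨rfl, rfl⟩ := List.cons.inj he
      exact ⟨v, w, by simpa [hZ, seekValue, hx] using hv, by simpa using hw, hp⟩
    | copyEnd hZ hx =>
      obtain ⟨w, hw, hp⟩ := hc'
      exact ⟨_, _, [], w, rfl, by simp [hZ, copyValue, hx], by simpa using hw, hp⟩
    | copyLetter hZ hf =>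
      obtain ⟨_, _, v, w, he, hv, hw, hp⟩ := hc'
      obtain ⟨rfl, rfl⟩ := List.cons.inj he
      refine ⟨_, _, _ :: v, w, rfl, ?_, by simpa using hw, hp.of_consumes hf⟩
      rw [List.map_cons, hZ, copyValue, hv]
      simp [isClosing, toLetter?]
    | copySkip hZ hx hl =>
      obtain ⟨_, _, v, w, he, hv, hw, hp⟩ := hc'
      obtain ⟨rfl, rfl⟩ := List.cons.inj he
      refine ⟨_, _, v, w, rfl, ?_, by simpa using hw, hp⟩
      rw [List.map_cons, hZ, copyValue, hv]
      simp [hx, hl]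
    | back =>
      obtain ⟨w, hw, hp⟩ := hc'
      exact ⟨w, by simpa using hw, hp⟩
  | readBottom h => exact absurd h (Set.notMem_empty _)

open Relation (ReflTransGen)

variable [Finite σ] [Finite Γ]

theorem Productive.of_reflTransGen {c : StackAutomaton.ID A (RefState σ k) Γ}
    {q : RefState σ k} {y z : List Γ} (h : ReflTransGen (automaton M g).Step c ⟨q, [], y, z⟩)
    (hq : q ∈ (automaton M g).final) : Productive M g c := by
  induction h using ReflTransGen.head_induction_on with
  | refl =>
    obtain rfl | ⟨rfl, -⟩ := hq
    · rfl
    · trivial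
  | head h _ ih => exact .of_step h ih

/-! ### Completeness of the simulation. -/

theorem reflTransGen_back (s : σ) (f : Bool) (a : A) (u : List A) (Z : Γ) (y z : List Γ) :
    ReflTransGen (automaton M g).Step ⟨back s f, a :: u, Z :: y, z⟩
      ⟨main s f, a :: u, z.reverse ++ Z :: y, []⟩ := by
  induction z generalizing Z y with
  | nil => exact .single (.push (d := stay) (w := [Z]) Push.back)
  | cons Y z ih =>
    have := ih Y (Z :: y)
    rw [List.reverse_cons, List.append_assoc]
    exact .head (.insideRight (d := stay) ReadInside.back) this

/-- The flag at the end is existential because the copy may consume the last input letter, depending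
on `w`. -/
theorem reflTransGen_copy {i : Fin k} {s : σ} {f : Bool} {u v w : List A} {Z : Γ} {y z : List Γ}
    (hv : copyValue i ((Z :: z).map g) = some v) (hp : Pending f (v ++ w) u) :
    ∃ f' u', Pending f' w u' ∧ ReflTransGen (automaton M g).Step ⟨copy i s f, u, Z :: y, z⟩
      ⟨main s f', u', z.reverse ++ Z :: y, []⟩ := by
  induction z generalizing Z y f u v with
  | nil =>
    obtain ⟨a, t, rfl⟩ := hp.exists_eq_cons
    cases hZ : g Z with
    | none => simp [hZ, copyValue] at hv
    | some x =>
      by_cases hx : isClosing i x = true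
      · obtain rfl : [] = v := by simpa [hZ, copyValue, hx] using hv
        exact ⟨f, _, hp, .single (.push (d := stay) (w := [Z]) (Push.copyEnd hZ hx))⟩
      · simp [hZ, copyValue, hx] at hv
  | cons Y z ih =>
    rw [List.reverse_cons, List.append_assoc]
    cases hZ : g Z with
    | none => simp [hZ, copyValue] at hv
    | some x =>
      by_cases hx : isClosing i x = true
      · obtain ⟨a, t, rfl⟩ := hp.exists_eq_cons
        obtain rfl : [] = v := by simpa [hZ, copyValue, hx] using hv
        exact ⟨f, _, hp, .head (.insideRight (d := stay) (ReadInside.copyEnd hZ hx))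
          (reflTransGen_back s f a t Y (Z :: y) z)⟩
      · rw [List.map_cons, hZ, copyValue, if_neg hx, Option.map_eq_some_iff] at hv
        obtain ⟨v', hv', rfl⟩ := hv
        cases hl : x.toLetter? with
        | none =>
          obtain ⟨a, t, rfl⟩ := hp.exists_eq_cons
          obtain ⟨f', u', hp', hr⟩ := ih (y := Z :: y) hv' (by simpa [hl] using hp)
          exact ⟨f', u', hp', .head (.insideRight (d := stay)
            (ReadInside.copySkip hZ (by simpa using hx) hl)) hr⟩
        | some a =>
          obtain rfl : x = .letter a := by cases x <;> simp_all [toLetter?]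
          obtain ⟨t, d, f₁, rfl, hf, hp₁⟩ := Pending.exists_consumes
            (show Pending f (a :: (v' ++ w)) u by simpa [toLetter?] using hp)
          obtain ⟨f', u', hp', hr⟩ := ih (y := Z :: y) hv' hp₁
          exact ⟨f', u', hp', .head (.insideRight (ReadInside.copyLetter hZ hf)) hr⟩

theorem reflTransGen_seek {i : Fin k} {s : σ} {f : Bool} {u v w : List A} {y z : List Γ}
    (hv : seekValue i (y.map g) (z.map g) = some v) (hp : Pending f (v ++ w) u) :
    ∃ f' u', Pending f' w u' ∧ ReflTransGen (automaton M g).Step ⟨seek i s f, u, y, z⟩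
      ⟨main s f', u', z.reverse ++ y, []⟩ := by
  induction y generalizing z with
  | nil => simp [seekValue] at hv
  | cons Z y ih =>
    obtain ⟨a, t, rfl⟩ := hp.exists_eq_cons
    cases hZ : g Z with
    | none =>
      obtain rfl : [] = v := by simpa [hZ, seekValue] using hv
      cases z with
      | nil => exact ⟨f, _, hp, .single (.push (d := stay) (w := [Z]) (Push.seekBottom hZ))⟩
      | cons Y z =>
        rw [List.reverse_cons, List.append_assoc]
        exact ⟨f, _, hp, .head (.insideRight (d := stay) (ReadInside.seekBottom hZ))
          (reflTransGen_back s f a t Y (Z :: y) z)⟩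
    | some x =>
      by_cases hx : isOpening i x = true
      · rw [List.map_cons, hZ, seekValue, if_pos hx] at hv
        cases z with
        | nil => simp [copyValue] at hv
        | cons Y z =>
          obtain ⟨f', u', hp', hr⟩ := reflTransGen_copy (M := M) (s := s) (y := Z :: y) hv hp
          rw [List.reverse_cons, List.append_assoc]
          exact ⟨f', u', hp', .head (.insideRight (d := stay) (ReadInside.seekFound hZ hx)) hr⟩
      · rw [List.map_cons, hZ, seekValue, if_neg hx, ← hZ, ← List.map_cons] at hv
        rw [Bool.not_eq_true] at hx
        obtain ⟨f', u', hp', hr⟩ := ih hv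
        rw [List.reverse_cons, List.append_assoc] at hr
        cases z with
        | nil => exact ⟨f', u', hp', .head (.readTop (d := stay) (ReadTop.seek hZ hx)) hr⟩
        | cons Y z =>
          exact ⟨f', u', hp', .head (.insideLeft (d := stay) (ReadInside.seek hZ hx)) hr⟩

theorem reflTransGen_main {s : σ} {f : Bool} {u w : List A} {v : List (RefSym A k)} {Z : Γ}
    {y : List Γ} (hv : M.evalFrom s v ∈ M.accept) (hw : emit ((Z :: y).map g) v = some w)
    (hp : Pending f w u) : ∃ y', ReflTransGen (automaton M g).Step ⟨main s f, u, Z :: y, []⟩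
      ⟨done, [], y', []⟩ := by
  induction v generalizing s f u w Z y with
  | nil =>
    obtain rfl := Option.some.inj hw
    cases f
    -- With no output left, the last letter must already be marked: an unmarked state still has
    -- pending input.
    · exact absurd hp.1.symm hp.2
    · obtain ⟨-, a, rfl⟩ := hp
      exact ⟨Z :: y, .single (.push (d := InputMove.right) (w := [Z]) (Push.accept hv))⟩
  | cons x v ih =>
    cases x with
    | letter a =>
      obtain ⟨w', hw', rfl⟩ := Option.map_eq_some_iff.1 hw
      obtain ⟨t, d, f₁, rfl, hf, hp₁⟩ := hp.exists_consumes
      obtain ⟨y', hr⟩ := ih (Z := g.symm (some (.letter a))) (y := Z :: y) hv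
        (by simpa using hw') hp₁
      exact ⟨y', .head (.push (w := [Z, _]) (Push.letter hf)) hr⟩
    | opening j =>
      obtain ⟨a, t, rfl⟩ := hp.exists_eq_cons
      obtain ⟨y', hr⟩ := ih (Z := g.symm (some (.opening j))) (y := Z :: y) hv
        (by simpa [emit] using hw) hp
      exact ⟨y', .head (.push (d := stay) (w := [Z, _]) (Push.opening j)) hr⟩
    | closing j =>
      obtain ⟨a, t, rfl⟩ := hp.exists_eq_cons
      obtain ⟨y', hr⟩ := ih (Z := g.symm (some (.closing j))) (y := Z :: y) hv
        (by simpa [emit] using hw) hp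
      exact ⟨y', .head (.push (d := stay) (w := [Z, _]) (Push.closing j)) hr⟩
    | ref i =>
      obtain ⟨c, hc, hcw⟩ := Option.bind_eq_some_iff.1 hw
      obtain ⟨w', hw', rfl⟩ := Option.map_eq_some_iff.1 hcw
      obtain ⟨a, t, rfl⟩ := hp.exists_eq_cons
      obtain ⟨f', u', hp', hr⟩ := reflTransGen_seek (M := M) (s := M.step s (.ref i)) (z := []) hc hp
      obtain ⟨y', hr'⟩ := ih hv hw' hp'
      exact ⟨y', .head (.push (d := stay) (w := [Z]) (Push.ref i)) (hr.trans hr')⟩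

theorem language_automaton : (automaton M g).language = emitLanguage M M.start [none] := by
  ext w
  constructor
  · rintro ⟨qf, hqf, y, z, h⟩
    -- A computation without moves can accept only the empty word, through the second kind of final
    -- state.
    rcases h.cases_head with h | ⟨c, hc, h⟩
    · injection h with h1 h2
      obtain rfl | ⟨-, hqf⟩ := hqf
      · exact absurd h1 (by simp [automaton])
      · exact h2 ▸ hqf
    · have hp := Productive.of_reflTransGen h hqf
      cases hc with
      | push hc =>
        change Push M g _ _ _ _ at hc
        cases hc
        obtain ⟨-, w, hw, rfl, -⟩ := hp
        simpa [automaton, InputMove.apply] using hw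
      | readTop hc =>
        change ReadTop g _ _ _ _ at hc
        cases hc
  · rintro ⟨v, hv, hw⟩
    cases w with
    | nil => exact ⟨init, Or.inr ⟨rfl, v, hv, hw⟩, _, _, .refl⟩
    | cons a w =>
      obtain ⟨y', hr⟩ := reflTransGen_main (M := M) (g := g) (f := false) (Z := g.symm none)
        (y := []) hv (by simpa using hw) ⟨rfl, by simp⟩
      exact ⟨done, Or.inl rfl, _, _,
        .head (.push (d := stay) (w := [g.symm none]) Push.start) hr⟩

end

end RefState

/-! ### Stack lookup agrees with dereferencing when no register is open at a reference. -/

namespace RefSym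

variable {A : Type u} {k : ℕ}

theorem copyValue_map_some (i : Fin k) (m : List (RefSym A k)) :
    copyValue i (m.map some) = if m.any (isClosing i) then
      some (eraseBrackets (m.takeWhile fun x => !isClosing i x)) else none := by
  induction m with
  | nil => rfl
  | cons x m ih =>
    rw [List.map_cons, copyValue, ih]
    by_cases hx : isClosing i x = true
    · simp [hx, eraseBrackets]
    · by_cases hm : m.any (isClosing i) = true
      · rw [if_neg hx, if_pos hm, if_pos (by simp [hm]), List.takeWhile_cons_of_pos (by simpa using hx)]
        cases h : x.toLetter? <;> simp [eraseBrackets, h]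
      · simp [hx, hm]

theorem seekValue_map_some (i : Fin k) (y z : List (RefSym A k)) :
    seekValue i (y.map some ++ [none]) (z.map some) = if y.any (isOpening i) then
      copyValue i (((y.takeWhile fun x => !isOpening i x).reverse ++ z).map some)
      else some [] := by
  induction y generalizing z with
  | nil => rfl
  | cons x y ih =>
    have := ih (x :: z)
    by_cases hx : isOpening i x = true
    · simp [seekValue, hx]
    · rw [List.map_cons] at this
      rw [List.map_cons, List.cons_append, seekValue, if_neg hx, this, List.any_cons,
        Bool.eq_false_iff.2 hx, Bool.false_or, List.takeWhile_cons_of_pos (by simpa using hx)]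
      simp

theorem seekValue_reverse (i : Fin k) (p : List (RefSym A k)) :
    seekValue i (p.reverse.map some ++ [none]) [] = capturedValue i p := by
  have := seekValue_map_some i p.reverse []
  rw [List.map_nil] at this
  rw [this, capturedValue, List.append_nil, copyValue_map_some, List.any_reverse]
  rfl

/-- Every register that is opened in `v` is closed in `v` afterwards. -/
def Settled (v : List (RefSym A k)) : Prop :=
  ∀ (i : Fin k) (r : Register A), (∀ w, r ≠ some (true, w)) →
    ∀ w, v.foldl (stepRegister i) r ≠ some (true, w)

theorem Settled.nil : Settled ([] : List (RefSym A k)) :=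
  fun _ _ h => h

theorem Settled.append {v w : List (RefSym A k)} (hv : Settled v) (hw : Settled w) :
    Settled (v ++ w) := fun i r hr => by
  rw [List.foldl_append]
  exact hw i _ (hv i r hr)

theorem Settled.letter (a : A) : Settled [(letter a : RefSym A k)] := by
  rintro i (_ | ⟨_ | _, c⟩) hr w
  · simp [stepRegister]
  · simp [stepRegister]
  · exact absurd rfl (hr c)

theorem Settled.ref (j : Fin k) : Settled [(ref j : RefSym A k)] :=
  fun _ _ hr => hr

/-- The final bracket closes register `j` whatever happened inside, and the other registers ignore
both brackets. -/
theorem Settled.capture {v : List (RefSym A k)} (hv : Settled v) (j : Fin k) :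
    Settled ([opening j] ++ v ++ [closing j]) := by
  intro i r hr w
  rw [List.foldl_append, List.foldl_append]
  by_cases hij : j = i
  · simp only [List.foldl_cons, List.foldl_nil, stepRegister, hij, if_true]
    generalize List.foldl _ _ _ = r'
    cases r' <;> simp
  · simp only [List.foldl_cons, List.foldl_nil, stepRegister, hij, if_false]
    exact hv i r hr w

/-- No reference occurs while a register is open. -/
def NoOpenReference (v : List (RefSym A k)) : Prop :=
  ∀ v₁ j v₂, v = v₁ ++ ref j :: v₂ → Settled v₁

theorem NoOpenReference.of_forall_ne {v : List (RefSym A k)} (h : ∀ j, ref j ∉ v) :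
    NoOpenReference v := by
  rintro v₁ j v₂ rfl
  exact absurd (by simp) (h j)

theorem NoOpenReference.append {v w : List (RefSym A k)} (hv : NoOpenReference v)
    (hv' : Settled v) (hw : NoOpenReference w) : NoOpenReference (v ++ w) := by
  intro v₁ j v₂ h
  rcases List.append_eq_append_iff.1 h with ⟨t, rfl, ht⟩ | ⟨t, rfl, ht⟩
  · exact hv'.append (hw _ _ _ ht)
  · cases t with
    | nil => simpa using hv'
    | cons x t =>
      obtain ⟨rfl, -⟩ := List.cons.inj ht
      exact hv _ _ _ rfl

/-- Dereferencing agrees with looking references up on a stack of letters and brackets. -/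
theorem derefFrom_eq_emit {v x p y : List (RefSym A k)}
    (hp : ∀ i, register i p = register i x) (hy : ∀ i, register i y = register i x)
    (hv : ∀ v₁ j v₂, v = v₁ ++ ref j :: v₂ → Settled (x ++ v₁)) :
    derefFrom p v = (emit (y.reverse.map some ++ [none]) v).map (eraseBrackets p ++ ·) := by
  -- Three versions of the string read so far: `x` with its references, `p` with them replaced, and
  -- `y`, the stack content, with them dropped. Only their registers have to agree.
  induction v generalizing x p y with
  | nil => simp [derefFrom, emit]
  | cons c v ih =>
    have hv' : ∀ v₁ j v₂, v = v₁ ++ ref j :: v₂ → Settled (x ++ [c] ++ v₁) := by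
      rintro v₁ j v₂ rfl
      simpa using hv (c :: v₁) j v₂ rfl
    have key : ∀ {q}, (∀ i, register i q = register i x) →
        ∀ i, register i (q ++ [c]) = register i (x ++ [c]) := fun hq i => by
      rw [register_append_singleton, register_append_singleton, hq]
    cases c with
    | letter a =>
      rw [derefFrom, ih (key hp) (key hy) hv']
      simp [emit, Function.comp_def, eraseBrackets, toLetter?]
    | opening j =>
      rw [derefFrom, ih (key hp) (key hy) hv']
      simp [emit, eraseBrackets, toLetter?, List.filterMap_cons]
    | closing j =>
      rw [derefFrom, ih (key hp) (key hy) hv']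
      simp [emit, eraseBrackets, toLetter?, List.filterMap_cons]
    | ref j =>
      have hc : capturedValue j p = seekValue j (y.reverse.map some ++ [none]) [] := by
        rw [seekValue_reverse, capturedValue_eq, capturedValue_eq, hp, hy]
      have hx : Settled x := by simpa using hv [] j v rfl
      rw [derefFrom, emit, hc]
      cases seekValue j (y.reverse.map some ++ [none]) [] with
      | none => rfl
      | some w =>
        have hw : ∀ i, register i (p ++ w.map letter) = register i (x ++ [ref j]) := by
          intro i
          rw [register_append, register_append_singleton, hp]
          -- The register is closed at this reference, so the letters substituted in `p` leave it
          -- unchanged.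
          have hr : ∀ w, register i x ≠ some (true, w) := hx i none (by simp)
          change _ = register i x
          generalize register i x = r at hr
          clear hc
          induction w with
          | nil => rfl
          | cons a w ihw =>
            have : stepRegister i r (letter a : RefSym A k) = r := by
              rcases r with _ | ⟨_ | _, c⟩
              · rfl
              · rfl
              · exact absurd rfl (hr c)
            rw [List.map_cons, List.foldl_cons, this, ihw]
        change derefFrom (p ++ w.map letter) v = _
        rw [ih hw (fun i => (hy i).trans (register_append_singleton i x (ref j)).symm) hv']
        simp [eraseBrackets_append, eraseBrackets_map_letter, Function.comp_def]

theorem deref_eq_emit {v : List (RefSym A k)} (hv : NoOpenReference v) :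
    deref v = emit [none] v := by
  rw [deref, derefFrom_eq_emit (x := []) (y := []) (fun _ => rfl) (fun _ => rfl)
    (fun v₁ j v₂ h => by simpa using hv v₁ j v₂ h)]
  simp [eraseBrackets]

instance [Finite A] : Finite (RefSym A k) := by
  let F : (A ⊕ Fin k) ⊕ (Fin k ⊕ Fin k) → RefSym A k
    | .inl (.inl a) => letter a
    | .inl (.inr j) => opening j
    | .inr (.inl j) => closing j
    | .inr (.inr j) => ref j
  refine Finite.of_surjective F fun x => ?_
  cases x with
  | letter a => exact ⟨.inl (.inl a), rfl⟩
  | opening j => exact ⟨.inl (.inr j), rfl⟩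
  | closing j => exact ⟨.inr (.inl j), rfl⟩
  | ref j => exact ⟨.inr (.inr j), rfl⟩

/-- Dereferencing a regular language without references inside open brackets yields a nonerasing
stack language. -/
theorem isNonerasingStackLanguage_deref [Finite A] {R : Language (RefSym A k)} (hR : R.IsRegular)
    (h : ∀ v ∈ R, NoOpenReference v) :
    IsNonerasingStackLanguage ({w | ∃ v ∈ R, deref v = some w} : Language A) := by
  obtain ⟨σ, _, M, rfl⟩ := hR
  let g := (Finite.equivFin (Option (RefSym A k))).symm
  refine ⟨RefState σ k, _, inferInstance, inferInstance, RefState.automaton M g,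
    RefState.automaton_nonerasing M g, ?_⟩
  rw [RefState.language_automaton]
  ext w
  constructor
  · rintro ⟨v, hv, hw⟩
    exact ⟨v, hv, (deref_eq_emit (h v hv)).trans hw⟩
  · rintro ⟨v, hv, hw⟩
    exact ⟨v, hv, (deref_eq_emit (h v hv)).symm.trans hw⟩

end RefSym

/-! ### Bracket structure of the strings generated by an expression. -/

namespace PreRewb

open RefSym

variable {A : Type u} {k : ℕ} {α : PreRewb A k}

theorem ReferenceFree.ref_notMem (h : α.ReferenceFree) :
    ∀ v ∈ α.refWords, ∀ j, RefSym.ref j ∉ v := by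
  induction α with
  | eps => rintro _ rfl j; simp
  | letter a => rintro _ rfl j; simp
  | ref i => exact h.elim
  | concat α β hα hβ =>
    intro v hv j
    obtain ⟨x, hx, w, hw, rfl⟩ := Language.mem_mul.1 hv
    simp [hα h.1 x hx j, hβ h.2 w hw j]
  | alt α β hα hβ =>
    intro v hv
    rcases hv with hv | hv
    · exact hα h.1 v hv
    · exact hβ h.2 v hv
  | star α hα =>
    intro v hv j
    obtain ⟨S, rfl, hS⟩ := Language.mem_kstar.1 hv
    simpa using fun w hw => hα h w (hS w hw) j
  | capture i α hα =>
    intro v hv j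
    obtain ⟨_, hx, _, rfl, rfl⟩ := Language.mem_mul.1 hv
    obtain ⟨_, rfl, y, hy, rfl⟩ := Language.mem_mul.1 hx
    simpa using hα h y hy j

theorem settled_of_mem_refWords : ∀ v ∈ α.refWords, Settled v := by
  induction α with
  | eps => rintro _ rfl; exact .nil
  | letter a => rintro _ rfl; exact .letter a
  | ref i => rintro _ rfl; exact .ref i
  | concat α β hα hβ =>
    intro v hv
    obtain ⟨x, hx, w, hw, rfl⟩ := Language.mem_mul.1 hv
    exact (hα x hx).append (hβ w hw)
  | alt α β hα hβ =>
    intro v hv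
    rcases hv with hv | hv
    · exact hα v hv
    · exact hβ v hv
  | star α hα =>
    intro v hv
    obtain ⟨S, rfl, hS⟩ := Language.mem_kstar.1 hv
    clear hv
    induction S with
    | nil => exact .nil
    | cons s S ih =>
      exact (hα s (hS s List.mem_cons_self)).append
        (ih fun y hy => hS y (List.mem_cons_of_mem _ hy))
  | capture i α hα =>
    intro v hv
    obtain ⟨_, hx, _, rfl, rfl⟩ := Language.mem_mul.1 hv
    obtain ⟨_, rfl, y, hy, rfl⟩ := Language.mem_mul.1 hx
    exact (hα y hy).capture i

/-- Captures contribute no references at all; elsewhere a reference is preceded by whole factors,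
which close every register they open. -/
theorem NoCapturedReference.noOpenReference (h : α.NoCapturedReference) :
    ∀ v ∈ α.refWords, NoOpenReference v := by
  induction α with
  | eps => rintro _ rfl; exact .of_forall_ne (by simp)
  | letter a => rintro _ rfl; exact .of_forall_ne (by simp)
  | ref i =>
    rintro _ rfl v₁ j v₂ hv
    have : v₁ = [] := by
      have := congrArg List.length hv
      simp at this
      exact List.length_eq_zero_iff.1 (by omega)
    exact this ▸ .nil
  | concat α β hα hβ =>
    intro v hv
    obtain ⟨x, hx, w, hw, rfl⟩ := Language.mem_mul.1 hv
    exact (hα h.1 x hx).append (settled_of_mem_refWords x hx) (hβ h.2 w hw)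
  | alt α β hα hβ =>
    intro v hv
    rcases hv with hv | hv
    · exact hα h.1 v hv
    · exact hβ h.2 v hv
  | star α hα =>
    intro v hv
    obtain ⟨S, rfl, hS⟩ := Language.mem_kstar.1 hv
    clear hv
    induction S with
    | nil => exact .of_forall_ne (by simp)
    | cons s S ih =>
      have hs := hS s List.mem_cons_self
      exact (hα h s hs).append (settled_of_mem_refWords s hs)
        (ih fun y hy => hS y (List.mem_cons_of_mem _ hy))
  | capture i α hα =>
    exact fun v hv => .of_forall_ne (ReferenceFree.ref_notMem (α := capture i α) h v hv)

end PreRewb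

/-! ### Consequences for rewbs. -/

namespace Rewb

open RefSym

variable {A : Type u}

/-- Every rewb is given by a regular language of strings with references. -/
theorem exists_isRegular_language_eq (α : Rewb A) :
    ∃ (k : ℕ) (R : Language (RefSym A k)), R.IsRegular ∧
      α.language = {w | ∃ v ∈ R, deref v = some w} ∧
      (α.NoCapturedReference → ∀ v ∈ R, NoOpenReference v) := by
  cases α with
  | backref k hk α hα =>
    exact ⟨k, _, α.isRegular_refWords, rfl, fun h => h.noOpenReference⟩
  | regular r =>
    have hmap : ∀ w : List A, NoOpenReference (w.map (letter (k := 0))) := fun w =>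
      .of_forall_ne (by simp)
    have hderef : ∀ w : List A, deref (w.map (letter (k := 0))) = some w := fun w => by
      have : ∀ p : List (RefSym A 0), derefFrom p (w.map letter) = some (eraseBrackets p ++ w) := by
        induction w with
        | nil => simp [derefFrom]
        | cons a w ih =>
          intro p
          rw [List.map_cons, derefFrom, ih]
          simp [eraseBrackets, toLetter?]
      simpa [eraseBrackets, deref] using this []
    -- An ordinary regular expression needs no labels, so `k = 0` works.
    refine ⟨0, (r.map letter).matches', RegularExpression.isRegular_matches' _, ?_, ?_⟩
    · rw [RegularExpression.matches'_map]
      refine Language.ext fun w => ⟨fun hw => ⟨_, ⟨w, hw, rfl⟩, hderef w⟩, ?_⟩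
      rintro ⟨_, ⟨v, hv, rfl⟩, hvw⟩
      rw [hderef] at hvw
      exact Option.some.inj hvw ▸ hv
    · rintro - v hv
      rw [RegularExpression.matches'_map] at hv
      obtain ⟨v, -, rfl⟩ := hv
      exact hmap v

theorem NoCapturedReference.isNonerasingStackLanguage [Finite A] {α : Rewb A}
    (h : α.NoCapturedReference) : IsNonerasingStackLanguage α.language := by
  obtain ⟨k, R, hR, hL, hR'⟩ := α.exists_isRegular_language_eq
  rw [hL]
  exact isNonerasingStackLanguage_deref hR (hR' h)

theorem language_ne_powPowLanguage (α : Rewb A) {a b : A} (hab : a ≠ b) :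
    α.language ≠ powPowLanguage a b := by
  obtain ⟨k, R, hR, hL, -⟩ := α.exists_isRegular_language_eq
  rw [hL]
  exact deref_ne_powPowLanguage hR hab

end Rewb

/-! ### A nonerasing stack automaton for `{aⁿ bⁿ}`. -/

/-- States of the automaton for `{aⁿ bⁿ | n ∈ ℕ}`: push a symbol for each `a`, then descend by one
symbol for each `b`. -/
inductive PowState : Type
  | init
  | push
  | pop
  | done

instance : Finite PowState :=
  Finite.of_surjective ![PowState.init, .push, .pop, .done] fun q => by
    cases q
    · exact ⟨0, rfl⟩
    · exact ⟨1, rfl⟩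
    · exact ⟨2, rfl⟩
    · exact ⟨3, rfl⟩

namespace PowState

open InputMove StackMove
open Relation (ReflTransGen)

variable {A : Type u} (a b : A)

/-- Moves in pushdown mode; the symbol `true` is at the bottom only. -/
inductive Push : PowState → A → Bool → PowState × InputMove × List Bool → Prop
  -- The bottom symbol itself counts the first `a`, so `j + 1` letters `a` leave `j` symbols `false`
  -- above it.
  | first : Push init a true (push, InputMove.right, [true])
  | next {Z} : Push push a Z (push, InputMove.right, [Z, false])
  -- Needed for exponent 1, where the bottom symbol is also the topmost one.
  | last : Push push b true (done, InputMove.right, [true])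

/-- Moves in stack reading mode at the top. -/
inductive ReadTop : PowState → A → Bool → PowState × InputMove → Prop
  | descend : ReadTop push b false (pop, InputMove.right)

/-- Moves in stack reading mode inside the stack. -/
inductive ReadInside : PowState → A → Bool → PowState × InputMove × StackMove → Prop
  | descend : ReadInside pop b false (pop, InputMove.right, left)
  | last : ReadInside pop b true (done, InputMove.right, StackMove.stay)

theorem Push.exists_eq_cons {a b : A} {q : PowState} {c : A} {Z : Bool}
    {m : PowState × InputMove × List Bool} (h : Push a b q c Z m) :
    ∃ w, m.2.2 = Z :: w ∧ w.length ≤ 1 := by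
  cases h <;> exact ⟨_, rfl, by simp⟩

/-- A nonerasing stack automaton for `{aⁿ bⁿ | n ∈ ℕ}`. -/
def automaton : StackAutomaton A PowState Bool where
  start := init
  initSym := true
  final := {init, done}
  push q c Z := {m | Push a b q c Z m}
  push_finite q c Z := by
    refine (Set.finite_univ.prod (Set.finite_univ.prod (List.finite_length_le Bool 2))).subset
      (s := Set.univ ×ˢ (Set.univ ×ˢ {l : List Bool | l.length ≤ 2})) ?_
    intro m hm
    obtain ⟨w, hw, hl⟩ := Push.exists_eq_cons hm
    exact ⟨trivial, trivial, by simpa [hw] using hl⟩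
  readTop q c Z := {m | ReadTop b q c Z m}
  readInside q c Z := {m | ReadInside b q c Z m}
  readBottom _ _ := ∅

theorem automaton_nonerasing : (automaton a b).Nonerasing :=
  fun _ _ _ _ _ _ h => let ⟨w, hw, _⟩ := Push.exists_eq_cons h; ⟨w, hw⟩

/-- The remaining input of a configuration has the shape required for acceptance. -/
def Productive (c : StackAutomaton.ID A PowState Bool) : Prop :=
  match c.state with
  | init => c.input ∈ powPowLanguage a b
  | push => ∃ j t m, c.left = List.replicate j false ++ true :: t ∧
      c.input = List.replicate m a ++ List.replicate (m + j + 1) b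
  | pop => ∃ j t, c.left = List.replicate j false ++ true :: t ∧
      c.input = List.replicate (j + 1) b
  | done => c.input = []

variable {a b}

theorem Productive.of_step {c c' : StackAutomaton.ID A PowState Bool}
    (h : (automaton a b).Step c c') (hc' : Productive a b c') : Productive a b c := by
  cases h with
  | push h =>
    change Push a b _ _ _ _ at h
    cases h with
    | first =>
      obtain ⟨j, t, m, ht, hu⟩ := hc'
      cases j with
      | zero => exact ⟨m + 1, congrArg (a :: ·) hu⟩
      | succ j => simp [List.replicate_succ] at ht
    | next =>
      obtain ⟨j, t, m, ht, hu⟩ := hc'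
      cases j with
      | zero => simp at ht
      | succ j =>
        refine ⟨j, t, m + 1, by simpa [List.replicate_succ] using ht, ?_⟩
        rw [show m + 1 + j + 1 = m + (j + 1) + 1 by omega]
        exact congrArg (a :: ·) hu
    | last => exact ⟨0, _, 0, rfl, congrArg (b :: ·) hc'⟩
  | readTop h =>
    change ReadTop b _ _ _ _ at h
    cases h
    obtain ⟨j, t, ht, hu⟩ := hc'
    refine ⟨j + 1, t, 0, congrArg (false :: ·) ht, (congrArg (b :: ·) hu).trans ?_⟩
    simp [List.replicate_succ]
  | insideLeft h =>
    change ReadInside b _ _ _ _ at h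
    cases h
    obtain ⟨j, t, ht, hu⟩ := hc'
    exact ⟨j + 1, t, congrArg (false :: ·) ht, congrArg (b :: ·) hu⟩
  | insideStay h =>
    change ReadInside b _ _ _ _ at h
    cases h
    exact ⟨0, _, rfl, congrArg (b :: ·) hc'⟩
  | insideRight h =>
    change ReadInside b _ _ _ _ at h
    cases h
  | readBottom h => exact absurd h (Set.notMem_empty _)

theorem exists_reflTransGen_pop (j : ℕ) (Y : Bool) (z : List Bool) :
    ∃ y' z', ReflTransGen (automaton a b).Step
      ⟨pop, List.replicate (j + 1) b, List.replicate j false ++ [true], Y :: z⟩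
      ⟨done, [], y', z'⟩ := by
  induction j generalizing Y z with
  | zero => exact ⟨_, _, .single (.insideStay (d := InputMove.right) ReadInside.last)⟩
  | succ j ih =>
    obtain ⟨y', z', h⟩ := ih false (Y :: z)
    exact ⟨y', z', .head (.insideLeft (d := InputMove.right) ReadInside.descend) h⟩

theorem exists_reflTransGen_push (m j : ℕ) :
    ∃ y' z', ReflTransGen (automaton a b).Step
      ⟨push, List.replicate m a ++ List.replicate (m + j + 1) b,
        List.replicate j false ++ [true], []⟩ ⟨done, [], y', z'⟩ := by
  induction m generalizing j with
  | zero =>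
    rw [List.replicate_zero, List.nil_append, Nat.zero_add]
    cases j with
    | zero =>
      exact ⟨_, _, .single (.push (d := InputMove.right) (w := [true]) (y := []) Push.last)⟩
    | succ j =>
      obtain ⟨y', z', h⟩ := exists_reflTransGen_pop (a := a) (b := b) j false []
      exact ⟨y', z', .head (.readTop (d := InputMove.right) ReadTop.descend) h⟩
  | succ m ih =>
    obtain ⟨y', z', h⟩ := ih (j + 1)
    rw [show m + (j + 1) + 1 = m + 1 + j + 1 by omega] at h
    refine ⟨y', z', .head ?_ h⟩
    -- The cases expose the top symbol, which the move must repeat before adding `false`.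
    cases j with
    | zero => exact .push (d := InputMove.right) (w := [true, false]) (y := []) Push.next
    | succ j => exact .push (d := InputMove.right) (w := [false, false]) Push.next

theorem language_automaton : (automaton a b).language = powPowLanguage a b := by
  ext w
  constructor
  · rintro ⟨qf, hqf, y, z, h⟩
    suffices ∀ c, ReflTransGen (automaton a b).Step c ⟨qf, [], y, z⟩ → Productive a b c from
      this _ h
    intro c h
    induction h using ReflTransGen.head_induction_on with
    | refl =>
      obtain rfl | rfl := hqf
      · exact ⟨0, rfl⟩
      · rfl
    | head h _ ih => exact .of_step h ih
  · rintro ⟨n, rfl⟩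
    cases n with
    | zero => exact ⟨init, Or.inl rfl, _, _, .refl⟩
    | succ n =>
      obtain ⟨y', z', h⟩ := exists_reflTransGen_push (a := a) (b := b) n 0
      exact ⟨done, Or.inr rfl, y', z',
        .head (.push (d := InputMove.right) (w := [true]) Push.first) h⟩

end PowState

theorem isNonerasingStackLanguage_powPowLanguage {A : Type u} (a b : A) :
    IsNonerasingStackLanguage (powPowLanguage a b) :=
  ⟨PowState, Bool, inferInstance, inferInstance, PowState.automaton a b,
    PowState.automaton_nonerasing a b, PowState.language_automaton⟩

theorem mainTheorem4 :
    -- over every finite alphabet, rewbs without a captured reference describe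
    -- nonerasing stack languages
    (∀ (A : Type u) [Finite A] (α : Rewb A), α.NoCapturedReference →
      IsNonerasingStackLanguage α.language) ∧
    -- but not vice versa
    (¬ ∀ (A : Type u) [Finite A] (L : Language A), IsNonerasingStackLanguage L →
      ∃ α : Rewb A, α.NoCapturedReference ∧ α.language = L) ∧
    -- as witnessed by `{aⁿ bⁿ | n ∈ ℕ}`, which no rewb at all describes
    (∀ (A : Type u) [Finite A] (a b : A), a ≠ b →
      IsNonerasingStackLanguage (powPowLanguage a b) ∧
      ∀ α : Rewb A, α.language ≠ powPowLanguage a b) := by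
  refine ⟨fun A _ α h => h.isNonerasingStackLanguage, fun h => ?_, fun A _ a b hab =>
    ⟨isNonerasingStackLanguage_powPowLanguage a b, fun α => α.language_ne_powPowLanguage hab⟩⟩
  -- `ULift` provides a two-letter alphabet in universe `u`.
  obtain ⟨α, -, hα⟩ := h (ULift Bool) _
    (isNonerasingStackLanguage_powPowLanguage (ULift.up true) (ULift.up false))
  exact α.language_ne_powPowLanguage (by simp) hα
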